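/- Let $n\not\equiv 2 \pmod 4$ be a positive integer which is not a prime power (i.e. not of the form $p^k$ with $p$ prime and $k\ge 1$), let $\zeta_n$ be a primitive $n$th root of unity, and let $K=\mathbb{Q}(\zeta_n+\zeta_n^{-1})$, a totally real number field. For a nonzero fractional ideal $I$ of $K$ put $I^*=\{x\in K : \mathrm{Tr}_{K/\mathbb{Q}}(xy)\in\mathbb{Z}\ \text{for all } y\in I\}$, the dual of the lattice $(I,(x,y)\mapsto \mathrm{Tr}_{K/\mathbb{Q}}(xy))$. For a positive integer $\ell$, this trace-type lattice is called Arakelov-modular of level $\ell$ if there is $\beta\in K^\times$ with $I=\beta I^*$ and $\ell=\beta^2$. Let $\mathrm{Mod}_T(n)$ be the set of square-free positive integers $\ell$ such that some nonzero fractional ideal of $K$ gives an Arakelov-modular lattice of trace type of level $\ell$ over $K$, and let $\tilde n$ be the product of all odd primes that ramify in $K/\mathbb{Q}$. If $n$ has a prime factor $p\equiv 1 \pmod 4$, then $\mathrm{Mod}_T(n)=\emptyset$. Otherwise: 1. if $n$ is odd and has an even number of distinct prime factors, then $\mathrm{Mod}_T(n)=\{\tilde n\}$; 2. if $n$ is odd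 and has an odd number of distinct prime factors, then $\mathrm{Mod}_T(n)=\emptyset$; 3. if $n=4m$ with $m$ odd, then $\mathrm{Mod}_T(n)=\{\tilde n\}$; 4. if $n=2^r m$ with $r\ge 3$ and $m$ odd, then $\mathrm{Mod}_T(n)=\{\tilde n, 2\tilde n\}$. -/

import Mathlib

open scoped nonZeroDivisors NumberField IntermediateField

noncomputable section

/-- An ideal lattice `(I, b_α)` over a totally real number field `K`: a (nonzero) fractional ideal
`I` of `K` together with a totally positive element `α` of `K`. -/
structure IdealLattice (K : Type*) [Field K] [NumberField K] where
  /-- the fractional ideal -/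
  I : FractionalIdeal (𝓞 K)⁰ K
  I_ne_zero : I ≠ 0
  /-- the twisting element -/
  α : K
  α_pos : ∀ σ : K →+* ℝ, 0 < σ α

namespace IdealLattice

variable {K : Type*} [Field K] [NumberField K]

/-- The bilinear form `b_α(x, y) = Tr_{K/ℚ}(α x y)`
(complex conjugation is the identity on a totally real field). -/
def form (Λ : IdealLattice K) : LinearMap.BilinForm ℚ K :=
  (Algebra.traceForm ℚ K).compLeft (LinearMap.mulLeft ℚ Λ.α)

/-- The underlying `ℤ`-module of the lattice. -/
def toSubmodule (Λ : IdealLattice K) : Submodule ℤ K :=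
  (Λ.I : Submodule (𝓞 K) K).restrictScalars ℤ

/-- The dual lattice `I* = {x ∈ K : b_α(x, y) ∈ ℤ for all y ∈ I}`. -/
def dual (Λ : IdealLattice K) : Submodule ℤ K :=
  Λ.form.dualSubmodule Λ.toSubmodule

theorem form_apply (Λ : IdealLattice K) (x y : K) :
    Λ.form x y = Algebra.trace ℚ K (Λ.α * x * y) := rfl

theorem mem_dual (Λ : IdealLattice K) (x : K) :
    x ∈ Λ.dual ↔ ∀ y ∈ Λ.I, ∃ m : ℤ, (m : ℚ) = Algebra.trace ℚ K (Λ.α * x * y) := by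
  simp only [dual, LinearMap.BilinForm.mem_dualSubmodule, Submodule.mem_one, form_apply]
  rfl

/-- The lattice is Arakelov-modular of level `ℓ`: there is `β ∈ Kˣ` with `I = β I*` and
`ℓ = β β̄ = β ^ 2` (complex conjugation is the identity on a totally real field). -/
def IsArakelovModular (Λ : IdealLattice K) (ℓ : ℕ) : Prop :=
  0 < ℓ ∧ ∃ β : K, β ≠ 0 ∧ Λ.toSubmodule = Λ.dual.map (LinearMap.mulLeft ℤ β) ∧ (ℓ : K) = β ^ 2

/-- The lattice is of trace type: `α = 1`. -/
def IsTraceType (Λ : IdealLattice K) : Prop := Λ.α = 1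

end IdealLattice

/-- The set of square-free levels `ℓ` for which there is an Arakelov-modular lattice of trace type
of level `ℓ` over the totally real number field `K`. -/
def traceTypeLevels (K : Type*) [Field K] [NumberField K] : Set ℕ :=
  {ℓ | Squarefree ℓ ∧ ∃ Λ : IdealLattice K, Λ.IsTraceType ∧ Λ.IsArakelovModular ℓ}

/-- The set `Ω(K)` of prime numbers that ramify in `K / ℚ`. -/
def ramifiedPrimes (K : Type*) [Field K] [NumberField K] : Set ℕ :=
  {p | p.Prime ∧ ∃ P : Ideal (𝓞 K), P.IsPrime ∧ P.LiesOver (Ideal.span {(p : ℤ)}) ∧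
    1 < P.ramificationIdx ℤ}

theorem ramifiedPrimes_finite (K : Type*) [Field K] [NumberField K] :
    (ramifiedPrimes K).Finite := by
  refine ((NumberField.discr K).natAbs.divisors.finite_toSet).subset ?_
  rintro p ⟨hp, P, hP, hover, he⟩
  have hp' : Prime (p : ℤ) := Nat.prime_iff_prime_int.mp hp
  have hdvd : (p : ℤ) ∣ NumberField.discr K := by
    by_contra h
    rw [NumberField.not_dvd_discr_iff_forall_mem K (𝓞 K) hp'] at h
    have hmem : ((p : ℤ) : 𝓞 K) ∈ P := (Ideal.liesOver_span_iff hP.ne_top hp').mp hover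
    have := h P hP hmem
    have h1 := Ideal.ramificationIdx_eq_one P ℤ
    omega
  simp only [Finset.mem_coe, Nat.mem_divisors, ne_eq, Int.natAbs_eq_zero]
  exact ⟨Int.natCast_dvd.mp hdvd, NumberField.discr_ne_zero K⟩

/-- The product of the odd primes that ramify in `K / ℚ` (the number `ñ` attached to
`K = ℚ(ζ_n + ζ_n⁻¹)`). -/
def oddRamifiedProduct (K : Type*) [Field K] [NumberField K] : ℕ :=
  ∏ p ∈ (ramifiedPrimes_finite K).toFinset.erase 2, p

end

/-! For trace type, `I* = I⁻¹ D⁻¹` with `D` the different of `K`, so `I = β I*` means `I² D = (β)`.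
Such an `I` exists iff every prime `P` of `K` has `v_P(β) + v_P(D)` even, where `2 v_P(β) = e_P
v_p(ℓ)` because `β² = ℓ` (`exists_isArakelovModular_iff`).

Since `n` is not a prime power, `ζ² - 1` is a unit and `L = ℚ(ζ)` has trivial different over `K`.
Hence `e_P` and `v_P(D)` agree with their values in `L`: for `n = p^(k+1) m` with `p ∤ m` they are
`p^k (p-1)` and `p^k ((p-1)(k+1) - 1)`. The second is odd for odd `p`, which forces `p ∣ ℓ` and
`(p-1)/2` odd; at 2 it is even, and `2 ∣ ℓ` is allowed only if `8 ∣ n`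
(`even_multiplicity_add_iff`). Only `ℓ = ñ`, or `2ñ` when `8 ∣ n`, survive.

It remains to decide whether `ℓ` is a square in `K`, equivalently in `L` since `ℓ > 0`. Gauss sums
make `(-1)^s ñ` a square in `L`, with `s` the number of odd primes dividing `n`; `-1` is a square if
`4 ∣ n` and not if `n` is odd, and 2 is a square if `8 ∣ n`. -/

theorem Ideal.exists_eq_sq_of_even_multiplicity {R : Type*} [CommRing R] [IsDedekindDomain R]
    {I : Ideal R} (hI : I ≠ 0) (h : ∀ P : Ideal R, Prime P → Even (multiplicity P I)) :
    ∃ J : Ideal R, I = J ^ 2 := by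
  classical
  obtain ⟨u, hu⟩ := Multiset.exists_smul_of_dvd_count (k := 2)
    (UniqueFactorizationMonoid.normalizedFactors I) (fun P hP => by
      have hP' := UniqueFactorizationMonoid.prime_of_normalized_factor P hP
      have := UniqueFactorizationMonoid.multiplicity_eq_count_normalizedFactors hP'.irreducible hI
      rw [normalize_eq] at this
      rw [← this]
      exact (h P hP').two_dvd)
  refine ⟨u.prod, ?_⟩
  rw [← Multiset.prod_nsmul, ← hu]
  exact (associated_iff_eq.mp (UniqueFactorizationMonoid.prod_normalizedFactors hI)).symm

theorem Ideal.multiplicity_mul_of_prime {R : Type*} [CommRing R] [IsDedekindDomain R]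
    {P I J : Ideal R} (hP : Prime P) (hI : I ≠ 0) (hJ : J ≠ 0) :
    multiplicity P (I * J) = multiplicity P I + multiplicity P J :=
  multiplicity_mul hP (FiniteMultiplicity.of_prime_left hP (mul_ne_zero hI hJ))

theorem Ideal.multiplicity_sq_of_prime {R : Type*} [CommRing R] [IsDedekindDomain R]
    {P I : Ideal R} (hP : Prime P) (hI : I ≠ 0) :
    multiplicity P (I ^ 2) = 2 * multiplicity P I := by
  rw [sq, Ideal.multiplicity_mul_of_prime hP hI hI, two_mul]

theorem Ideal.multiplicity_map_of_liesOver {R S : Type*} [CommRing R] [IsDedekindDomain R]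
    [CommRing S] [IsDedekindDomain S] [Algebra R S] [Module.IsTorsionFree R S]
    {P : Ideal R} {Q : Ideal S} (hP : Prime P) (hQ : Prime Q) [Q.LiesOver P] {I : Ideal R}
    (hI : I ≠ 0) :
    multiplicity Q (I.map (algebraMap R S)) = Q.ramificationIdx R * multiplicity P I := by
  have : Q.IsPrime := Ideal.isPrime_of_prime hQ
  have h := Ideal.IsDedekindDomain.emultiplicity_map_eq_ramificationIdx'_mul hI hP.irreducible
    hQ.irreducible hQ.ne_zero (S := S)
  rw [Ideal.ramificationIdx'_eq_ramificationIdx P Q hP.ne_zero,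
    (FiniteMultiplicity.of_prime_left hQ
      (by simpa using Ideal.map_ne_bot_of_ne_bot hI)).emultiplicity_eq_multiplicity,
    (FiniteMultiplicity.of_prime_left hP hI).emultiplicity_eq_multiplicity] at h
  exact_mod_cast h

/-! ### Arakelov-modularity as an equation of ideals -/

section NumberField

variable {K : Type*} [Field K] [NumberField K]

theorem differentIdeal_int_ne_zero : differentIdeal ℤ (𝓞 K) ≠ 0 := by
  have := NumberField.absNorm_differentIdeal K (𝓞 K)
  intro h
  rw [h] at this
  exact NumberField.discr_ne_zero K (by simpa using this.symm)

theorem IdealLattice.dual_eq_of_isTraceType {Λ : IdealLattice K} (h : Λ.IsTraceType) :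
    Λ.dual = (FractionalIdeal.dual ℤ ℚ Λ.I : Submodule (𝓞 K) K).restrictScalars ℤ := by
  ext x
  rw [IdealLattice.mem_dual, Submodule.restrictScalars_mem, FractionalIdeal.mem_coe,
    FractionalIdeal.mem_dual Λ.I_ne_zero, h]
  simp [RingHom.mem_range, Algebra.traceForm_apply]

theorem IdealLattice.isArakelovModular_iff {Λ : IdealLattice K} (h : Λ.IsTraceType) (ℓ : ℕ) :
    Λ.IsArakelovModular ℓ ↔ 0 < ℓ ∧ ∃ β : K, β ≠ 0 ∧ (ℓ : K) = β ^ 2 ∧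
      Λ.I ^ 2 * (differentIdeal ℤ (𝓞 K) : FractionalIdeal (𝓞 K)⁰ K) =
        FractionalIdeal.spanSingleton _ β := by
  have key (β : K) : Λ.toSubmodule = Λ.dual.map (LinearMap.mulLeft ℤ β) ↔
      Λ.I ^ 2 * (differentIdeal ℤ (𝓞 K) : FractionalIdeal (𝓞 K)⁰ K) =
        FractionalIdeal.spanSingleton _ β := by
    have h1 : Λ.toSubmodule = Λ.dual.map (LinearMap.mulLeft ℤ β) ↔
        Λ.I = FractionalIdeal.spanSingleton _ β * FractionalIdeal.dual ℤ ℚ Λ.I := by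
      rw [IdealLattice.dual_eq_of_isTraceType h]
      constructor
      · intro H
        ext x
        have := SetLike.ext_iff.mp H x
        simp only [IdealLattice.toSubmodule, Submodule.restrictScalars_mem,
          FractionalIdeal.mem_coe, Submodule.mem_map, LinearMap.mulLeft_apply] at this
        rw [this, FractionalIdeal.mem_singleton_mul]
        simp only [eq_comm]
      · intro H
        ext x
        simp only [IdealLattice.toSubmodule, Submodule.restrictScalars_mem,
          FractionalIdeal.mem_coe, Submodule.mem_map, LinearMap.mulLeft_apply]
        conv_lhs => rw [H]
        rw [FractionalIdeal.mem_singleton_mul]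
        simp only [eq_comm]
    have hI := Λ.I_ne_zero
    have hD : FractionalIdeal.dual ℤ ℚ (1 : FractionalIdeal (𝓞 K)⁰ K) ≠ 0 :=
      FractionalIdeal.dual_ne_zero ℤ ℚ one_ne_zero
    rw [h1, FractionalIdeal.dual_eq_mul_inv ℤ ℚ, coeIdeal_differentIdeal ℤ ℚ K (𝓞 K),
      mul_inv_eq_iff_eq_mul₀ hD, sq, ← mul_assoc, eq_mul_inv_iff_mul_eq₀ hI]
  simp only [IdealLattice.IsArakelovModular, key]
  tauto

/-- A positive integer `ℓ` is the level of some Arakelov-modular lattice of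
trace type if and only if it has a square root `β` such that `(β)` and the different have
valuations of the same parity everywhere. -/
theorem exists_isArakelovModular_iff (ℓ : ℕ) (hℓ : 0 < ℓ) :
    (∃ Λ : IdealLattice K, Λ.IsTraceType ∧ Λ.IsArakelovModular ℓ) ↔
      ∃ β : 𝓞 K, (ℓ : 𝓞 K) = β ^ 2 ∧ ∀ P : Ideal (𝓞 K), Prime P →
        Even (multiplicity P (Ideal.span {β}) + multiplicity P (differentIdeal ℤ (𝓞 K))) := by
  have hD := differentIdeal_int_ne_zero (K := K)
  constructor
  · rintro ⟨Λ, hΛ, hmod⟩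
    obtain ⟨-, β, hβ0, hβ, hI⟩ := (IdealLattice.isArakelovModular_iff hΛ ℓ).mp hmod
    have hint : IsIntegral ℤ β := by
      refine IsIntegral.of_pow two_pos (hβ ▸ ?_)
      simpa using isIntegral_algebraMap (R := ℤ) (A := K) (x := (ℓ : ℤ))
    obtain ⟨b, rfl⟩ : ∃ b : 𝓞 K, (b : K) = β := ⟨⟨β, hint⟩, rfl⟩
    have hb0 : b ≠ 0 := by rintro rfl; simp at hβ0
    refine ⟨b, by exact_mod_cast hβ, fun P hP => ?_⟩
    obtain ⟨c, J, hc, hJ⟩ := FractionalIdeal.exists_eq_spanSingleton_mul Λ.I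
    have hJ0 : J ≠ 0 := by
      rintro rfl
      apply Λ.I_ne_zero
      simpa using hJ
    have hc' : algebraMap (𝓞 K) K c ≠ 0 := by simpa using hc
    -- Clearing the denominator `c` of `I` changes the valuations only by an even amount.
    have key : J ^ 2 * differentIdeal ℤ (𝓞 K) = Ideal.span {c} ^ 2 * Ideal.span {b} := by
      rw [← FractionalIdeal.coeIdeal_inj (K := K)]
      simp only [FractionalIdeal.coeIdeal_mul, FractionalIdeal.coeIdeal_pow,
        FractionalIdeal.coeIdeal_span_singleton]
      rw [← hI, hJ, mul_pow, mul_assoc, ← mul_assoc, FractionalIdeal.spanSingleton_pow,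
        FractionalIdeal.spanSingleton_pow, FractionalIdeal.spanSingleton_mul_spanSingleton,
        ← mul_pow, mul_inv_cancel₀ hc', one_pow, FractionalIdeal.spanSingleton_one, one_mul]
    have hcs : Ideal.span {c} ≠ 0 := by simpa using hc
    have hbs : Ideal.span {b} ≠ 0 := by simpa using hb0
    have := congrArg (multiplicity P) key
    rw [Ideal.multiplicity_mul_of_prime hP (pow_ne_zero _ hJ0) hD,
      Ideal.multiplicity_mul_of_prime hP (pow_ne_zero _ hcs) hbs,
      Ideal.multiplicity_sq_of_prime hP hJ0, Ideal.multiplicity_sq_of_prime hP hcs] at this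
    rw [Nat.even_iff]
    omega
  · rintro ⟨b, hb, hP⟩
    have hb0 : b ≠ 0 := by
      rintro rfl
      simp [hℓ.ne'] at hb
    have hbs : Ideal.span {b} ≠ 0 := by simpa using hb0
    obtain ⟨M, hM⟩ := Ideal.exists_eq_sq_of_even_multiplicity (mul_ne_zero hbs hD)
      (fun P h => by rw [Ideal.multiplicity_mul_of_prime h hbs hD]; exact hP P h)
    have hM0 : M ≠ 0 := by
      rintro rfl
      exact mul_ne_zero hbs hD (by simpa using hM)
    have hD' : (differentIdeal ℤ (𝓞 K) : FractionalIdeal (𝓞 K)⁰ K) ≠ 0 :=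
      FractionalIdeal.coeIdeal_ne_zero.mpr hD
    -- With `(b) D = M²`, the ideal `I = M D⁻¹` satisfies `I² D = M² D⁻¹ = (b)`.
    refine ⟨⟨M * (differentIdeal ℤ (𝓞 K) : FractionalIdeal (𝓞 K)⁰ K)⁻¹,
      mul_ne_zero (FractionalIdeal.coeIdeal_ne_zero.mpr hM0) (inv_ne_zero hD'), 1, by simp⟩, rfl, ?_⟩
    refine (IdealLattice.isArakelovModular_iff (by rfl) ℓ).mpr ⟨hℓ, b, by simpa using hb0, by exact_mod_cast congrArg (algebraMap (𝓞 K) K) hb, ?_⟩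
    have := congrArg (fun I : Ideal (𝓞 K) => (I : FractionalIdeal (𝓞 K)⁰ K)) hM
    simp only [FractionalIdeal.coeIdeal_mul, FractionalIdeal.coeIdeal_pow,
        FractionalIdeal.coeIdeal_span_singleton] at this
    rw [mul_pow, ← this]
    field_simp

end NumberField

/-! ### The cyclotomic field is unramified over its real subfield -/

theorem IsPrimitiveRoot.isUnit_sub_one_of_not_prime_pow {R : Type*} [CommRing R] [IsDomain R]
    {n : ℕ} {η : R} (hη : IsPrimitiveRoot η n) (hn0 : 0 < n)
    (hn : ∀ {p : ℕ}, p.Prime → ∀ k : ℕ, p ^ k ≠ n) : IsUnit (η - 1) := by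
  have h := Polynomial.eval_one_cyclotomic_not_prime_pow (R := R) hn
  rw [Polynomial.cyclotomic_eq_prod_X_sub_primitiveRoots hη, Polynomial.eval_prod] at h
  have hmem : η ∈ primitiveRoots n R := (mem_primitiveRoots hn0).mpr hη
  have : IsUnit (Polynomial.eval 1 (Polynomial.X - Polynomial.C η)) :=
    isUnit_of_dvd_one ((Finset.dvd_prod_of_mem
      (fun μ => Polynomial.eval 1 (Polynomial.X - Polynomial.C μ)) hmem).trans h.dvd)
  rw [← neg_sub, IsUnit.neg_iff]
  simpa using this

/-- Write `f = g h` with `g` the minimal polynomial of `z`. Then `f'(z) = g'(z) h(z)`, so `g'(z)` is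
a unit, and it lies in the different. -/
theorem differentIdeal_eq_top_of_isUnit_aeval_derivative {K L : Type*} [Field K] [NumberField K]
    [Field L] [NumberField L] [Algebra K L] {z : 𝓞 L}
    (hz : Algebra.adjoin K {(z : L)} = ⊤) {f : Polynomial (𝓞 K)}
    (hf : Polynomial.aeval z f = 0) (hf' : IsUnit (Polynomial.aeval z f.derivative)) :
    differentIdeal (𝓞 K) (𝓞 L) = ⊤ := by
  have hint : IsIntegral (𝓞 K) z := Algebra.IsIntegral.isIntegral z
  obtain ⟨g, rfl⟩ := minpoly.isIntegrallyClosed_dvd hint hf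
  rw [Polynomial.derivative_mul, map_add, map_mul, map_mul, minpoly.aeval, zero_mul,
    add_zero] at hf'
  exact Ideal.eq_top_of_isUnit_mem _ (aeval_derivative_mem_differentIdeal (𝓞 K) K L z hz)
    (isUnit_of_mul_isUnit_left hf')

/-- `ζ` is a root of `f = X² - aX + 1`, and `ζ f'(ζ) = ζ² - 1`, a unit because the order of `ζ²` is
not a prime power. -/
theorem IsPrimitiveRoot.differentIdeal_eq_top {K L : Type*} [Field K] [NumberField K]
    [Field L] [NumberField L] [Algebra K L] {n : ℕ} (hn0 : 0 < n) (hn2 : ¬ n ≡ 2 [MOD 4])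
    (hnpp : ¬ IsPrimePow n) {ζ : L} (hζ : IsPrimitiveRoot ζ n)
    (hadj : Algebra.adjoin K {ζ} = ⊤) {a : K} (ha : algebraMap K L a = ζ + ζ⁻¹) :
    differentIdeal (𝓞 K) (𝓞 L) = ⊤ := by
  have : NeZero n := ⟨hn0.ne'⟩
  have hz := hζ.toInteger_isPrimitiveRoot
  set z := hζ.toInteger with hzdef
  have hzζ : (z : L) = ζ := rfl
  -- For `n = 1` the quadratic is `(X - 1)²`, whose derivative vanishes at `ζ = 1`; `X - 1` replaces
  -- it.
  rcases eq_or_ne n 1 with rfl | hn1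
  · have hz1 : z = 1 := by simpa using hz
    refine differentIdeal_eq_top_of_isUnit_aeval_derivative (z := z) (by simpa [hzζ] using hadj)
      (f := Polynomial.X - 1) (by simp [hz1]) (by simp)
  have hζ0 : ζ ≠ 0 := hζ.ne_zero hn0.ne'
  have hζint : IsIntegral ℤ ζ := hζ.isIntegral hn0
  have hζint' : IsIntegral ℤ ζ⁻¹ := hζ.inv.isIntegral hn0
  have haint : IsIntegral ℤ a := by
    rw [← isIntegral_algebraMap_iff (algebraMap K L).injective (B := L), ha]
    exact hζint.add hζint'
  let b : 𝓞 K := ⟨a, haint⟩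
  have hb : z * algebraMap (𝓞 K) (𝓞 L) b = z ^ 2 + 1 := by
    apply NumberField.RingOfIntegers.ext
    have : ((algebraMap (𝓞 K) (𝓞 L) b : 𝓞 L) : L) = ζ + ζ⁻¹ := ha
    simp only [map_mul, this, hzζ, map_add, map_pow, map_one]
    field_simp
  refine differentIdeal_eq_top_of_isUnit_aeval_derivative (z := z) (by simpa [hzζ] using hadj)
      (f := Polynomial.X ^ 2 - Polynomial.C b * Polynomial.X + 1) ?_ ?_
  · simp only [map_add, map_sub, map_pow, Polynomial.aeval_X, map_mul, Polynomial.aeval_C, map_one]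
    linear_combination -hb
  · have hu : IsUnit (z ^ 2 - 1) := by
      rcases Nat.even_or_odd n with he | ho
      · have hn4 : 4 ∣ n := by
          rw [Nat.ModEq] at hn2
          rw [Nat.even_iff] at he
          omega
        -- Here `ζ²` has order `2m`; were this a prime power, it would be a power of 2, and so would
        -- `n`.
        obtain ⟨m, rfl⟩ := hn4
        have := hz.pow (a := 2) (b := 2 * m) hn0 (by ring)
        refine this.isUnit_sub_one_of_not_prime_pow (by omega) (fun {p} hp k hk => hnpp ?_)
        have hk0 : k ≠ 0 := by rintro rfl; simp at hk; omega
        have h2 : 2 ∣ p ^ k := ⟨m, hk⟩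
        have := (Nat.prime_dvd_prime_iff_eq Nat.prime_two hp).mp (Nat.prime_two.dvd_of_dvd_pow h2)
        subst this
        exact (isPrimePow_nat_iff _).mpr ⟨2, k + 1, hp, by omega, by rw [pow_succ, hk]; ring⟩
      · have := hz.pow_of_coprime 2 (Nat.coprime_two_left.mpr ho)
        refine this.isUnit_sub_one_of_not_prime_pow hn0 (fun {p} hp k hk => hnpp ?_)
        have hk0 : k ≠ 0 := by rintro rfl; simp at hk; omega
        exact (isPrimePow_nat_iff _).mpr ⟨p, k, hp, by omega, hk⟩
    have heq : z * Polynomial.aeval z (Polynomial.derivative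
        (Polynomial.X ^ 2 - Polynomial.C b * Polynomial.X + 1 : Polynomial (𝓞 K))) = z ^ 2 - 1 := by
      simp
      linear_combination -hb
    exact isUnit_of_mul_isUnit_right (heq ▸ hu)

theorem Ideal.multiplicity_eq_of_differentIdeal_eq_top {K L : Type*} [Field K] [NumberField K]
    [Field L] [NumberField L] [Algebra K L] (h : differentIdeal (𝓞 K) (𝓞 L) = ⊤)
    {P : Ideal (𝓞 K)} {Q : Ideal (𝓞 L)} (hP : Prime P) (hQ : Prime Q) [Q.LiesOver P] :
    P.ramificationIdx ℤ = Q.ramificationIdx ℤ ∧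
      multiplicity P (differentIdeal ℤ (𝓞 K)) = multiplicity Q (differentIdeal ℤ (𝓞 L)) := by
  have : Q.IsPrime := Ideal.isPrime_of_prime hQ
  have hun : Algebra.IsUnramifiedAt (𝓞 K) Q := by
    rw [← not_dvd_differentIdeal_iff, h, ← Ideal.one_eq_top]
    exact fun h => hQ.not_isUnit (isUnit_of_dvd_one h)
  have he : Q.ramificationIdx (𝓞 K) = 1 := Ideal.ramificationIdx_eq_one Q (𝓞 K)
  refine ⟨by rw [Ideal.ramificationIdx_tower (R := ℤ) P Q, he, mul_one], ?_⟩
  rw [differentIdeal_eq_differentIdeal_mul_differentIdeal ℤ (𝓞 K) (𝓞 L), h, Ideal.top_mul,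
    Ideal.multiplicity_map_of_liesOver hP hQ differentIdeal_int_ne_zero, he, one_mul]

theorem Ideal.multiplicity_differentIdeal_of_ramificationIdx_eq {K L : Type*} [Field K]
    [NumberField K] [Field L] [NumberField L] [Algebra K L]
    {P : Ideal (𝓞 K)} {Q : Ideal (𝓞 L)} (hP : Prime P) (hQ : Prime Q) [Q.LiesOver P]
    (h : P.ramificationIdx ℤ = Q.ramificationIdx ℤ) :
    multiplicity Q (differentIdeal ℤ (𝓞 L)) = multiplicity P (differentIdeal ℤ (𝓞 K)) := by
  have : Q.IsPrime := Ideal.isPrime_of_prime hQ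
  have : P.IsPrime := Ideal.isPrime_of_prime hP
  have he : Q.ramificationIdx (𝓞 K) = 1 := by
    have h1 := Ideal.ramificationIdx_tower (R := ℤ) P Q
    have h2 := P.ramificationIdx_pos ℤ
    rw [← h] at h1
    exact (Nat.mul_eq_left h2.ne').mp h1.symm
  have hun : ¬ Q ∣ differentIdeal (𝓞 K) (𝓞 L) :=
    not_dvd_differentIdeal_iff.mpr (Ideal.ramificationIdx_eq_one_iff.mp he)
  have hne : differentIdeal (𝓞 K) (𝓞 L) ≠ 0 := by
    intro h0
    exact hun (h0 ▸ dvd_zero Q)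
  rw [differentIdeal_eq_differentIdeal_mul_differentIdeal ℤ (𝓞 K) (𝓞 L),
    Ideal.multiplicity_mul_of_prime hQ hne
      (by simpa using Ideal.map_ne_bot_of_ne_bot differentIdeal_int_ne_zero),
    multiplicity_eq_zero.mpr hun, Ideal.multiplicity_map_of_liesOver hP hQ
      differentIdeal_int_ne_zero, he, one_mul, zero_add]

theorem Ideal.prime_of_liesOver_span {K : Type*} [Field K] [NumberField K] {p : ℕ} (hp : p.Prime)
    (P : Ideal (𝓞 K)) [hP : P.IsPrime] [P.LiesOver (Ideal.span {(p : ℤ)})] : Prime P :=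
  Ideal.prime_of_isPrime (Ideal.ne_bot_of_liesOver_of_ne_bot
    (p := Ideal.span {(p : ℤ)}) (by simpa using hp.ne_zero) P) hP

/-! ### Different exponents in cyclotomic fields -/

namespace IsCyclotomicExtension.Rat

/-- `P` is the only prime above `p` and has norm `p`. The norm of the different is the discriminant,
a power of `p`, so its exponent is the multiplicity. -/
theorem multiplicity_differentIdeal_of_prime_pow (p k : ℕ) [hp : Fact p.Prime] (F : Type*) [Field F]
    [NumberField F] [IsCyclotomicExtension {p ^ (k + 1)} ℚ F] (P : Ideal (𝓞 F)) [P.IsPrime]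
    [P.LiesOver (Ideal.span {(p : ℤ)})] :
    multiplicity P (differentIdeal ℤ (𝓞 F)) = p ^ k * ((p - 1) * (k + 1) - 1) := by
  have hζ := zeta_spec (p ^ (k + 1)) ℚ F
  have hPeq := eq_span_zeta_sub_one_of_liesOver p k F hζ P
  have hPrime := Ideal.prime_of_liesOver_span hp.out P
  have hnorm : Ideal.absNorm P = p := by
    have h1 := Ideal.natAbs_pow_inertiaDeg (p : ℤ) P
    rw [inertiaDeg_eq_of_prime_pow p k F P] at h1
    simpa using h1.symm
  have hD := differentIdeal_int_ne_zero (K := F)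
  obtain ⟨J, hJ, hPJ⟩ := (FiniteMultiplicity.of_prime_left hPrime hD).exists_eq_pow_mul_and_not_dvd
  have hN := NumberField.absNorm_differentIdeal F (𝓞 F)
  rw [discr_prime_pow_succ p k F, hJ, map_mul, map_pow, hnorm] at hN
  simp only [Int.natAbs_mul, Int.natAbs_pow, Int.natAbs_neg, Int.natAbs_one, one_pow, one_mul,
    Int.natAbs_natCast] at hN
  obtain ⟨i, -, hi⟩ := (Nat.dvd_prime_pow hp.out).mp (Dvd.intro_left _ hN)
  have hi0 : i = 0 := by
    by_contra h
    have hdvd : (p : ℤ) ∣ (Ideal.absNorm J : ℤ) := by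
      rw [hi]; exact_mod_cast dvd_pow_self p h
    obtain ⟨M, hM, h₁, h₂⟩ := Ideal.exists_isMaximal_dvd_of_dvd_absNorm
      (Nat.prime_iff_prime_int.mp hp.out) _ hdvd
    have : M.LiesOver (Ideal.span {(p : ℤ)}) := ⟨h₁.symm⟩
    exact hPJ (hPeq ▸ eq_span_zeta_sub_one_of_liesOver p k F hζ M ▸ h₂)
  rw [hi, hi0, pow_zero, mul_one] at hN
  exact Nat.pow_right_injective hp.out.two_le hN

/-- The subfield of `p^(k+1)`-th roots of unity already carries all the ramification at `p`, so the
different exponent is unchanged on passing up to `L`. -/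
theorem multiplicity_differentIdeal {n p k m : ℕ} [hp : Fact p.Prime] (L : Type*) [Field L]
    [NumberField L] [IsCyclotomicExtension {n} ℚ L] (hn : n = p ^ (k + 1) * m) (hm : ¬ p ∣ m)
    (Q : Ideal (𝓞 L)) [Q.IsPrime] [Q.LiesOver (Ideal.span {(p : ℤ)})] :
    multiplicity Q (differentIdeal ℤ (𝓞 L)) = p ^ k * ((p - 1) * (k + 1) - 1) := by
  have : NeZero m := ⟨fun h ↦ by simp [h] at hm⟩
  have : NeZero n := ⟨hn ▸ NeZero.ne (p ^ (k + 1) * m)⟩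
  have hζ := zeta_spec n ℚ L
  have hζₚ := hζ.pow (NeZero.pos _) (mul_comm _ m ▸ hn)
  let F := ℚ⟮(zeta n ℚ L) ^ m⟯
  have : IsCyclotomicExtension {p ^ (k + 1)} ℚ F :=
    (IntermediateField.isCyclotomicExtension_singleton_iff_eq_adjoin _ _ _ _ hζₚ).mpr rfl
  let P : Ideal (𝓞 F) := Q.under (𝓞 F)
  have : P.IsPrime := inferInstance
  have : P.LiesOver (Ideal.span {(p : ℤ)}) := Ideal.LiesOver.tower_bot Q P _
  rw [← multiplicity_differentIdeal_of_prime_pow p k F P]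
  refine Ideal.multiplicity_differentIdeal_of_ramificationIdx_eq
    (Ideal.prime_of_liesOver_span hp.out P) (Ideal.prime_of_liesOver_span hp.out Q) ?_
  rw [ramificationIdx_eq_of_prime_pow p k F P, ramificationIdx_eq n L Q hn hm]

theorem multiplicity_differentIdeal_of_not_dvd {n p : ℕ} [NeZero n] [hp : Fact p.Prime]
    (L : Type*) [Field L] [NumberField L] [IsCyclotomicExtension {n} ℚ L] (hn : ¬ p ∣ n)
    (Q : Ideal (𝓞 L)) [Q.IsPrime] [Q.LiesOver (Ideal.span {(p : ℤ)})] :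
    multiplicity Q (differentIdeal ℤ (𝓞 L)) = 0 := by
  refine multiplicity_eq_zero.mpr (not_dvd_differentIdeal_iff.mpr ?_)
  exact Ideal.ramificationIdx_eq_one_iff.mp (ramificationIdx_eq_of_not_dvd p L Q hn)

end IsCyclotomicExtension.Rat

/-! ### The parity condition prime by prime -/

theorem Ideal.multiplicity_natCast_of_liesOver {K : Type*} [Field K] [NumberField K] {p ℓ : ℕ}
    (hp : p.Prime) (hℓ : ℓ ≠ 0) (P : Ideal (𝓞 K)) [P.IsPrime]
    [P.LiesOver (Ideal.span {(p : ℤ)})] :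
    multiplicity P (Ideal.span {(ℓ : 𝓞 K)}) = P.ramificationIdx ℤ * multiplicity p ℓ := by
  have h := Ideal.multiplicity_map_of_liesOver (P := Ideal.span {(p : ℤ)}) (Q := P)
    (I := Ideal.span {(ℓ : ℤ)})
    (by simpa [Ideal.prime_span_singleton_iff] using Nat.prime_iff_prime_int.mp hp)
    (Ideal.prime_of_liesOver_span hp P) (by simpa using hℓ)
  rw [Ideal.map_span, Set.image_singleton] at h
  rw [← Int.natCast_multiplicity, ← show multiplicity (Ideal.span {(p : ℤ)}) (Ideal.span {(ℓ : ℤ)}) =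
    multiplicity (p : ℤ) (ℓ : ℤ) from ?_, ← h]
  · simp
  · exact multiplicity_eq_of_emultiplicity_eq Ideal.emultiplicity_eq_emultiplicity_span

section Parity

variable {K L : Type*} [Field K] [NumberField K] [Field L] [NumberField L] [Algebra K L] {n p : ℕ}
  [hn : NeZero n] [hp : Fact p.Prime] [IsCyclotomicExtension {n} ℚ L]

omit hn in
theorem IsCyclotomicExtension.Rat.ramificationIdx_and_multiplicity_differentIdeal_of_eq_top
    (hKL : differentIdeal (𝓞 K) (𝓞 L) = ⊤) {k m : ℕ} (hnm : n = p ^ (k + 1) * m) (hm : ¬ p ∣ m)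
    (P : Ideal (𝓞 K)) [P.IsPrime] [P.LiesOver (Ideal.span {(p : ℤ)})] :
    P.ramificationIdx ℤ = p ^ k * (p - 1) ∧
      multiplicity P (differentIdeal ℤ (𝓞 K)) = p ^ k * ((p - 1) * (k + 1) - 1) := by
  have hP := Ideal.prime_of_liesOver_span hp.out P
  have : P.IsMaximal := Ideal.IsPrime.isMaximal inferInstance hP.ne_zero
  obtain ⟨Q, _, _⟩ := Ideal.exists_maximal_ideal_liesOver_of_isIntegral P (S := 𝓞 L)
  have : Q.LiesOver (Ideal.span {(p : ℤ)}) := Ideal.LiesOver.trans Q P _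
  obtain ⟨h1, h2⟩ := Ideal.multiplicity_eq_of_differentIdeal_eq_top hKL hP
    (Ideal.prime_of_liesOver_span hp.out Q)
  rw [h1, h2]
  exact ⟨ramificationIdx_eq n L Q hnm hm, multiplicity_differentIdeal L hnm hm Q⟩

theorem IsCyclotomicExtension.Rat.ramificationIdx_and_multiplicity_differentIdeal_of_not_dvd
    (hKL : differentIdeal (𝓞 K) (𝓞 L) = ⊤) (hpn : ¬ p ∣ n)
    (P : Ideal (𝓞 K)) [P.IsPrime] [P.LiesOver (Ideal.span {(p : ℤ)})] :
    P.ramificationIdx ℤ = 1 ∧ multiplicity P (differentIdeal ℤ (𝓞 K)) = 0 := by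
  have hP := Ideal.prime_of_liesOver_span hp.out P
  have : P.IsMaximal := Ideal.IsPrime.isMaximal inferInstance hP.ne_zero
  obtain ⟨Q, _, _⟩ := Ideal.exists_maximal_ideal_liesOver_of_isIntegral P (S := 𝓞 L)
  have : Q.LiesOver (Ideal.span {(p : ℤ)}) := Ideal.LiesOver.trans Q P _
  obtain ⟨h1, h2⟩ := Ideal.multiplicity_eq_of_differentIdeal_eq_top hKL hP
    (Ideal.prime_of_liesOver_span hp.out Q)
  rw [h1, h2]
  exact ⟨ramificationIdx_eq_of_not_dvd p L Q hpn, multiplicity_differentIdeal_of_not_dvd L hpn Q⟩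

/-- The condition at the prime `p` that a square-free `ℓ` has to satisfy in order to be the level of
an Arakelov-modular lattice of trace type over `ℚ(ζ_n + ζ_n⁻¹)`. -/
def LevelCondition (n ℓ p : ℕ) : Prop :=
  (¬ p ∣ n → ¬ p ∣ ℓ) ∧ (p ∣ n → p ≠ 2 → p ∣ ℓ ∧ p % 4 = 3) ∧
    (p = 2 → p ∣ n → ¬ 8 ∣ n → ¬ p ∣ ℓ)

omit hn hp in
theorem Nat.multiplicity_eq_ite_of_squarefree {ℓ : ℕ} (hp : p.Prime) (hℓ : Squarefree ℓ) :
    multiplicity p ℓ = if p ∣ ℓ then 1 else 0 := by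
  split_ifs with h
  · refine multiplicity_eq_of_dvd_of_not_dvd (by simpa) fun h2 => ?_
    exact hp.one_lt.ne' (Nat.isUnit_iff.mp (hℓ p (by simpa [sq] using h2)))
  · exact multiplicity_eq_zero.mpr h

theorem even_multiplicity_add_iff (hn2 : ¬ n ≡ 2 [MOD 4])
    (hKL : differentIdeal (𝓞 K) (𝓞 L) = ⊤) {ℓ : ℕ} (hℓ : Squarefree ℓ)
    {β : 𝓞 K} (hβ : (ℓ : 𝓞 K) = β ^ 2) (P : Ideal (𝓞 K)) [P.IsPrime]
    [P.LiesOver (Ideal.span {(p : ℤ)})] :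
    Even (multiplicity P (Ideal.span {β}) + multiplicity P (differentIdeal ℤ (𝓞 K))) ↔
      LevelCondition n ℓ p := by
  have hP := Ideal.prime_of_liesOver_span hp.out P
  have hβ0 : Ideal.span {β} ≠ 0 := by
    have : β ≠ 0 := by
      rintro rfl
      simp [hℓ.ne_zero] at hβ
    simpa using this
  have hv : 2 * multiplicity P (Ideal.span {β}) =
      P.ramificationIdx ℤ * if p ∣ ℓ then 1 else 0 := by
    rw [← Ideal.multiplicity_sq_of_prime hP hβ0, Ideal.span_singleton_pow, ← hβ,
      Ideal.multiplicity_natCast_of_liesOver hp.out hℓ.ne_zero,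
      Nat.multiplicity_eq_ite_of_squarefree hp.out hℓ]
  set v := multiplicity P (Ideal.span {β})
  by_cases hpn : p ∣ n
  · obtain ⟨j, m, hm, hnm⟩ := Nat.exists_eq_pow_mul_and_not_dvd hn.out p hp.out.ne_one
    obtain ⟨k, rfl⟩ : ∃ k, j = k + 1 := by
      refine Nat.exists_eq_succ_of_ne_zero ?_
      rintro rfl
      exact hm (by simpa [hnm] using hpn)
    obtain ⟨he, hd⟩ := IsCyclotomicExtension.Rat.ramificationIdx_and_multiplicity_differentIdeal_of_eq_top
      hKL hnm hm P
    rw [he] at hv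
    rw [hd]
    rcases hp.out.eq_two_or_odd' with h2 | hodd
    · subst h2
      have hk : k ≠ 0 := by
        rintro rfl
        rw [Nat.ModEq] at hn2
        omega
      have h8 : 8 ∣ n ↔ 2 ≤ k := by
        constructor
        · intro h
          by_contra hk2
          have : k = 1 := by omega
          subst this
          rw [hnm] at h
          omega
        · intro h
          obtain ⟨i, rfl⟩ := Nat.exists_eq_add_of_le h
          rw [hnm]
          exact ⟨2 ^ i * m, by ring⟩
      obtain ⟨i, rfl⟩ := Nat.exists_eq_succ_of_ne_zero hk
      -- Here `n = 2^(i+2) m`, so when `2 ∣ ℓ` the valuation of `β` is odd exactly for `i = 0`, that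
      -- is `8 ∤ n`.
      have hv' : v = 2 ^ i * if 2 ∣ ℓ then 1 else 0 := by
        have : 2 ^ (i + 1) * (2 - 1) = 2 * 2 ^ i := by ring
        rw [Nat.succ_eq_add_one, this, mul_assoc] at hv
        omega
      have hed : Even (2 ^ i.succ * ((2 - 1) * (i.succ + 1) - 1)) :=
        ((even_two.pow_of_ne_zero (by omega))).mul_right _
      rw [Nat.even_add, iff_true_right hed, hv']
      simp only [LevelCondition, hpn, h8]
      split_ifs with h
      · simp [Nat.even_pow, h]
      · simp [h]
    · have hp2 : p ≠ 2 := by rintro rfl; exact absurd hodd (by decide)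
      have hpk : Odd (p ^ k) := hodd.pow
      obtain ⟨t, ht⟩ := hodd
      have hd' : Odd (p ^ k * ((p - 1) * (k + 1) - 1)) := by
        refine hpk.mul ?_
        have ht0 : 0 < t := by have := hp.out.two_le; omega
        have : (p - 1) * (k + 1) - 1 = 2 * (t * (k + 1) - 1) + 1 := by
          have h1 : (p - 1) * (k + 1) = 2 * (t * (k + 1)) := by
            rw [ht, Nat.add_sub_cancel]; ring
          have h2 : 0 < t * (k + 1) := by positivity
          omega
        exact ⟨_, this⟩
      have hv' : v = p ^ k * t * if p ∣ ℓ then 1 else 0 := by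
        have : p ^ k * (p - 1) = 2 * (p ^ k * t) := by
          rw [show p - 1 = 2 * t by omega]; ring
        rw [this, mul_assoc] at hv
        omega
      rw [Nat.even_add, iff_false_right (Nat.not_even_iff_odd.mpr hd'), hv', Nat.not_even_iff_odd]
      simp only [LevelCondition, hpn]
      split_ifs with h
      · have : p % 4 = 3 ↔ t % 2 = 1 := by omega
        simp [Nat.odd_mul, hpk, h, this, hp2, Nat.odd_iff (n := t)]
      · simp [h, hp2]
  · obtain ⟨he, hd⟩ :=
      IsCyclotomicExtension.Rat.ramificationIdx_and_multiplicity_differentIdeal_of_not_dvd hKL hpn P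
    rw [he] at hv
    -- At an unramified prime, `p ∣ ℓ` would give `2v = 1`.
    have hpℓ : ¬ p ∣ ℓ := by
      intro h
      simp only [h, if_true] at hv
      omega
    simp only [hpℓ, if_false] at hv
    have hv0 : v = 0 := by omega
    simp [hd, hv0, LevelCondition, hpn, hpℓ]

omit hp in
theorem mem_traceTypeLevels_iff (hn2 : ¬ n ≡ 2 [MOD 4])
    (hKL : differentIdeal (𝓞 K) (𝓞 L) = ⊤) {ℓ : ℕ} :
    ℓ ∈ traceTypeLevels K ↔ Squarefree ℓ ∧ (∃ x : K, x ^ 2 = ℓ) ∧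
      ∀ p : ℕ, p.Prime → LevelCondition n ℓ p := by
  refine and_congr_right fun hℓ => ?_
  rw [exists_isArakelovModular_iff ℓ (Nat.pos_of_ne_zero hℓ.ne_zero)]
  constructor
  · rintro ⟨β, hβ, h⟩
    refine ⟨⟨β, by exact_mod_cast (congrArg (algebraMap (𝓞 K) K) hβ).symm⟩, fun p hp => ?_⟩
    have := Fact.mk hp
    have : (Ideal.span {(p : ℤ)}).IsMaximal :=
      Ideal.IsPrime.isMaximal
        ((Ideal.span_singleton_prime (by simpa using hp.ne_zero)).mpr (Nat.prime_iff_prime_int.mp hp))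
        (by simpa using hp.ne_zero)
    obtain ⟨P, _, _⟩ :=
      Ideal.exists_maximal_ideal_liesOver_of_isIntegral (Ideal.span {(p : ℤ)}) (S := 𝓞 K)
    exact (even_multiplicity_add_iff hn2 hKL hℓ hβ P).mp (h P (Ideal.prime_of_liesOver_span hp P))
  · rintro ⟨⟨x, hx⟩, h⟩
    have hint : IsIntegral ℤ x := by
      refine IsIntegral.of_pow two_pos (hx ▸ ?_)
      simpa using isIntegral_algebraMap (R := ℤ) (A := K) (x := (ℓ : ℤ))
    obtain ⟨b, rfl⟩ : ∃ b : 𝓞 K, (b : K) = x := ⟨⟨x, hint⟩, rfl⟩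
    have hb : (ℓ : 𝓞 K) = b ^ 2 := by
      apply NumberField.RingOfIntegers.ext
      simpa using hx.symm
    refine ⟨b, hb, fun P hP => ?_⟩
    have : P.IsPrime := Ideal.isPrime_of_prime hP
    have : NeZero P := ⟨hP.ne_zero⟩
    obtain ⟨p, hp, hpP⟩ : ∃ p : ℕ, p.Prime ∧ P.LiesOver (Ideal.span {(p : ℤ)}) :=
      ⟨P.under ℤ |>.absNorm, Nat.absNorm_under_prime P, inferInstance⟩
    have := Fact.mk hp
    exact (even_multiplicity_add_iff hn2 hKL hℓ hb P).mpr (h p hp)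

omit hp in
theorem mem_ramifiedPrimes_iff_of_ne_two (hKL : differentIdeal (𝓞 K) (𝓞 L) = ⊤) (hp2 : p ≠ 2) :
    p ∈ ramifiedPrimes K ↔ p.Prime ∧ p ∣ n := by
  refine and_congr_right fun hp => ?_
  have := Fact.mk hp
  constructor
  · rintro ⟨P, _, _, h⟩
    by_contra hpn
    rw [(IsCyclotomicExtension.Rat.ramificationIdx_and_multiplicity_differentIdeal_of_not_dvd
      hKL hpn P).1] at h
    exact lt_irrefl _ h
  · intro hpn
    have : (Ideal.span {(p : ℤ)}).IsMaximal :=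
      Ideal.IsPrime.isMaximal
        ((Ideal.span_singleton_prime (by simpa using hp.ne_zero)).mpr (Nat.prime_iff_prime_int.mp hp))
        (by simpa using hp.ne_zero)
    obtain ⟨P, hP, _⟩ :=
      Ideal.exists_maximal_ideal_liesOver_of_isIntegral (Ideal.span {(p : ℤ)}) (S := 𝓞 K)
    obtain ⟨j, m, hm, hnm⟩ := Nat.exists_eq_pow_mul_and_not_dvd hn.out p hp.ne_one
    obtain ⟨k, rfl⟩ : ∃ k, j = k + 1 := by
      refine Nat.exists_eq_succ_of_ne_zero ?_
      rintro rfl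
      exact hm (by simpa [hnm] using hpn)
    refine ⟨P, hP.isPrime, inferInstance, ?_⟩
    rw [(IsCyclotomicExtension.Rat.ramificationIdx_and_multiplicity_differentIdeal_of_eq_top
      hKL hnm hm P).1]
    have h1 : 1 ≤ p ^ k := Nat.one_le_pow _ _ hp.pos
    have h2 : 2 ≤ p - 1 := by have := hp.two_le; omega
    nlinarith

omit hp in
theorem oddRamifiedProduct_eq (hKL : differentIdeal (𝓞 K) (𝓞 L) = ⊤) :
    oddRamifiedProduct K = ∏ p ∈ n.primeFactors.erase 2, p := by
  refine Finset.prod_congr ?_ fun _ _ => rfl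
  ext p
  simp only [Finset.mem_erase, Set.Finite.mem_toFinset, Nat.mem_primeFactors]
  refine and_congr_right fun hp2 => ?_
  rw [mem_ramifiedPrimes_iff_of_ne_two (n := n) hKL hp2]
  simp [hn.out]

end Parity

/-! ### Square roots in cyclotomic fields and descent to the real subfield -/

/-- The quadratic Gauss sum squares to `χ(-1) p`, and `χ(-1) = -1` for `p ≡ 3 mod 4`. -/
theorem IsPrimitiveRoot.exists_sq_eq_neg_prime {F : Type*} [Field F] [CharZero F] {p : ℕ}
    (hp : p.Prime) (hp4 : p % 4 = 3) {ζ : F} (hζ : IsPrimitiveRoot ζ p) :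
    ∃ y : F, y ^ 2 = -(p : F) := by
  have := Fact.mk hp
  have hp2 : ringChar (ZMod p) ≠ 2 := by
    rw [ZMod.ringChar_zmod_n]
    omega
  have hχ : (quadraticChar (ZMod p)).ringHomComp (Int.castRingHom F) ≠ 1 :=
    (MulChar.ringHomComp_ne_one_iff (RingHom.injective_int _)).mpr (quadraticChar_ne_one hp2)
  have hχ' := (quadraticChar_isQuadratic (ZMod p)).comp (Int.castRingHom F)
  have h := gaussSum_sq hχ hχ' (AddChar.zmodChar_primitive_of_primitive_root p hζ)
  refine ⟨_, h.trans ?_⟩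
  rw [MulChar.ringHomComp_apply, quadraticChar_neg_one hp2, ZMod.card,
    ZMod.χ₄_nat_three_mod_four hp4]
  simp

theorem IsPrimitiveRoot.exists_sq_eq_neg_one_pow_mul_prod {F : Type*} [Field F] [CharZero F] {n : ℕ}
    (hn : 0 < n) {ζ : F} (hζ : IsPrimitiveRoot ζ n) (s : Finset ℕ)
    (hs : ∀ p ∈ s, p.Prime ∧ p ∣ n ∧ p % 4 = 3) :
    ∃ y : F, y ^ 2 = (-1) ^ s.card * ((∏ p ∈ s, p : ℕ) : F) := by
  have h (p : ℕ) : ∃ y : F, p ∈ s → y ^ 2 = -(p : F) := by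
    by_cases hps : p ∈ s
    · obtain ⟨hp, ⟨m, hm⟩, hp4⟩ := hs p hps
      obtain ⟨y, hy⟩ := (hζ.pow hn (hm.trans (mul_comm _ _))).exists_sq_eq_neg_prime hp hp4
      exact ⟨y, fun _ => hy⟩
    · exact ⟨0, fun h => absurd h hps⟩
  choose y hy using h
  refine ⟨∏ p ∈ s, y p, ?_⟩
  rw [← Finset.prod_pow, Finset.prod_congr rfl hy, Finset.prod_neg, Nat.cast_prod]

theorem IsPrimitiveRoot.exists_sq_eq_neg_one {F : Type*} [Field F] {n : ℕ} (hn : 0 < n)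
    (h4 : 4 ∣ n) {ζ : F} (hζ : IsPrimitiveRoot ζ n) : ∃ y : F, y ^ 2 = -1 := by
  obtain ⟨m, hm⟩ := h4
  have h := (hζ.pow hn (hm.trans (mul_comm _ _))).pow (a := 2) (b := 2) (by norm_num) rfl
  exact ⟨_, h.eq_neg_one_of_two_right⟩

theorem IsPrimitiveRoot.exists_sq_eq_two {F : Type*} [Field F] {n : ℕ} (hn : 0 < n)
    (h8 : 8 ∣ n) {ζ : F} (hζ : IsPrimitiveRoot ζ n) : ∃ y : F, y ^ 2 = 2 := by
  obtain ⟨m, hm⟩ := h8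
  have h0 := hζ.pow hn (hm.trans (mul_comm _ _))
  have h := (h0.pow (a := 4) (b := 2) (by norm_num) rfl).eq_neg_one_of_two_right
  -- With `ω = ζ^m` of order 8, `-ω³ = ω⁻¹`, so this is `ω + ω⁻¹`.
  refine ⟨ζ ^ m - (ζ ^ m) ^ 3, ?_⟩
  linear_combination ((ζ ^ m) ^ 2 - 2) * h

/-- For odd `n` the roots of unity are `±ζ^r`, so `y^(2n) = 1`, whereas `y² = -1` gives `(-1)^n =
-1`. -/
theorem IsPrimitiveRoot.not_exists_sq_eq_neg_one {F : Type*} [Field F] [NumberField F] {n : ℕ}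
    [IsCyclotomicExtension {n} ℚ F] (hn : Odd n) {ζ : F} (hζ : IsPrimitiveRoot ζ n) :
    ¬ ∃ y : F, y ^ 2 = -1 := by
  rintro ⟨y, hy⟩
  have : NeZero n := ⟨hn.pos.ne'⟩
  have hfin : IsOfFinOrder y := isOfFinOrder_iff_pow_eq_one.mpr
    ⟨4, by norm_num, by rw [show 4 = 2 * 2 from rfl, pow_mul, hy]; norm_num⟩
  obtain ⟨r, hr⟩ := hζ.exists_neg_pow_of_isOfFinOrder hn hfin
  have h1 : y ^ (2 * n) = 1 := by
    rw [hr, ← pow_mul, mul_comm, pow_mul, pow_mul, neg_sq,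
      pow_right_comm ζ, hζ.pow_eq_one, one_pow, one_pow]
  rw [pow_mul, hy, hn.neg_one_pow] at h1
  norm_num at h1

theorem exists_eq_add_mul_of_adjoin_eq_top {K L : Type*} [Field K] [Field L] [Algebra K L]
    {ζ : L} (hζ0 : ζ ≠ 0) (hadj : Algebra.adjoin K {ζ} = ⊤) {a : K}
    (ha : algebraMap K L a = ζ + ζ⁻¹) (x : L) :
    ∃ u v : K, x = algebraMap K L u + algebraMap K L v * ζ := by
  have hx : x ∈ Algebra.adjoin K {ζ} := hadj ▸ Algebra.mem_top
  have hsq : ζ ^ 2 = algebraMap K L a * ζ - 1 := by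
    rw [ha]
    field_simp
    ring
  induction hx using Algebra.adjoin_induction with
  | mem x hx => exact ⟨0, 1, by simpa using hx⟩
  | algebraMap r => exact ⟨r, 0, by simp⟩
  | add x y _ _ hx hy =>
    obtain ⟨u, v, rfl⟩ := hx
    obtain ⟨u', v', rfl⟩ := hy
    exact ⟨u + u', v + v', by simp only [map_add]; ring⟩
  | mul x y _ _ hx hy =>
    obtain ⟨u, v, rfl⟩ := hx
    obtain ⟨u', v', rfl⟩ := hy
    refine ⟨u * u' - v * v', u * v' + u' * v + a * v * v', ?_⟩
    simp only [map_add, map_sub, map_mul]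
    linear_combination algebraMap K L v * algebraMap K L v' * hsq

/-- A square root in `L = ℚ(ζ_n)` of a positive integer is contained in the real subfield
`K = ℚ(ζ_n + ζ_n⁻¹)`. -/
theorem IsPrimitiveRoot.exists_algebraMap_eq_of_sq_eq_natCast {K L : Type*} [Field K] [Field L]
    [NumberField L] [Algebra K L] {n : ℕ} (hn0 : 0 < n) (hn2 : n ≠ 2) {ζ : L}
    (hζ : IsPrimitiveRoot ζ n) (hadj : Algebra.adjoin K {ζ} = ⊤) {a : K}
    (ha : algebraMap K L a = ζ + ζ⁻¹)
    (hreal : ∀ (φ : L →+* ℂ) (y : K), (φ (algebraMap K L y)).im = 0)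
    {ℓ : ℕ} (hℓ : 0 < ℓ) {x : L} (hx : x ^ 2 = ℓ) : ∃ y : K, algebraMap K L y = x := by
  obtain ⟨u, v, huv⟩ := exists_eq_add_mul_of_adjoin_eq_top (hζ.ne_zero hn0.ne') hadj ha x
  rcases eq_or_ne n 1 with rfl | hn1
  · exact ⟨u + v, by rw [huv, IsPrimitiveRoot.one_right_iff.mp hζ]; simp⟩
  -- Under `φ`, `x = u + vζ` is real since `ℓ > 0`, as are `u` and `v`, while `ζ` is not real; hence
  -- `v = 0`.
  have φ : L →+* ℂ := Classical.choice (inferInstance : Nonempty (L →+* ℂ))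
  have hφx : (φ x).im = 0 := by
    have h : φ x ^ 2 = ℓ := by rw [← map_pow, hx, map_natCast]
    have h1 := congrArg Complex.re h
    have h2 := congrArg Complex.im h
    simp only [sq, Complex.mul_re, Complex.mul_im, Complex.natCast_re, Complex.natCast_im] at h1 h2
    have hℓ' : (0 : ℝ) < ℓ := by exact_mod_cast hℓ
    have hre : (φ x).re ≠ 0 := by
      intro h0
      rw [h0] at h1
      nlinarith [mul_self_nonneg (φ x).im]
    have : (φ x).re * (φ x).im = 0 := by linarith
    exact (mul_eq_zero.mp this).resolve_left hre
  have hφζ : (φ ζ).im ≠ 0 := by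
    intro h0
    have hprim : IsPrimitiveRoot (φ ζ) n := hζ.map_of_injective φ.injective
    have hnorm := hprim.norm'_eq_one hn0.ne'
    have hsq : φ ζ ^ 2 = 1 := by
      have hre : (φ ζ).re * (φ ζ).re = 1 := by
        have := Complex.sq_norm (φ ζ)
        rw [hnorm, Complex.normSq_apply, h0] at this
        linarith
      apply Complex.ext <;> simp [sq, Complex.mul_re, Complex.mul_im, h0, hre]
    have := Nat.le_of_dvd two_pos (hprim.dvd_of_pow_eq_one 2 hsq)
    omega
  rw [huv, map_add, map_mul, Complex.add_im, Complex.mul_im, hreal, hreal, zero_mul, add_zero,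
    zero_add] at hφx
  have hv : v = 0 := by
    have hre := (mul_eq_zero.mp hφx).resolve_right hφζ
    have : φ (algebraMap K L v) = 0 := Complex.ext hre (hreal φ v)
    simpa using this
  exact ⟨u, by rw [huv, hv]; simp⟩

theorem squarefree_and_levelCondition_iff {n ℓ : ℕ} (hn : 0 < n) :
    (Squarefree ℓ ∧ ∀ p : ℕ, p.Prime → LevelCondition n ℓ p) ↔
      (∀ p ∈ n.primeFactors.erase 2, p % 4 = 3) ∧
        (ℓ = ∏ p ∈ n.primeFactors.erase 2, p ∨
          (8 ∣ n ∧ ℓ = 2 * ∏ p ∈ n.primeFactors.erase 2, p)) := by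
  have hmem (p : ℕ) : p ∈ n.primeFactors.erase 2 ↔ p ≠ 2 ∧ p.Prime ∧ p ∣ n := by
    simp [hn.ne']
  constructor
  · rintro ⟨hℓ, h⟩
    refine ⟨fun p hp => ?_, ?_⟩
    · obtain ⟨hp2, hp, hpn⟩ := (hmem p).mp hp
      exact ((h p hp).2.1 hpn hp2).2
    · have hset : ℓ.primeFactors.erase 2 = n.primeFactors.erase 2 := by
        ext p
        rw [hmem]
        simp only [Finset.mem_erase, Nat.mem_primeFactors, hℓ.ne_zero, ne_eq, not_false_eq_true,
          and_true]
        refine and_congr_right fun hp2 => and_congr_right fun hp => ⟨fun hpℓ => ?_, fun hpn => ?_⟩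
        · by_contra hpn
          exact (h p hp).1 hpn hpℓ
        · exact ((h p hp).2.1 hpn hp2).1
      have hprod := Nat.prod_primeFactors_of_squarefree hℓ
      by_cases h2 : 2 ∣ ℓ
      · obtain ⟨h21, -, h23⟩ := h 2 Nat.prime_two
        refine Or.inr ⟨by_contra fun h8 => h23 rfl (by_contra fun h => h21 h h2) h8 h2, ?_⟩
        rw [← hset, Finset.mul_prod_erase (f := fun p => p) _
          (Nat.mem_primeFactors.mpr ⟨Nat.prime_two, h2, hℓ.ne_zero⟩), hprod]
      · left
        rw [← hset, Finset.erase_eq_of_notMem (by simp [h2]), hprod]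
  · rintro ⟨h3, hℓ⟩
    set N := ∏ p ∈ n.primeFactors.erase 2, p with hN
    have hdvd (p : ℕ) (hp : p.Prime) : p ∣ N ↔ p ∈ n.primeFactors.erase 2 := by
      rw [hN, hp.prime.dvd_finsetProd_iff]
      constructor
      · rintro ⟨q, hq, hpq⟩
        rwa [(Nat.prime_dvd_prime_iff_eq hp ((hmem q).mp hq).2.1).mp hpq]
      · exact fun h => ⟨p, h, dvd_rfl⟩
    have h2N : ¬ 2 ∣ N := by simp [hdvd 2 Nat.prime_two]
    have hsqN : Squarefree N := by
      refine Finset.squarefree_prod_of_pairwise_isCoprime (fun p hp q hq hpq => ?_)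
        fun p hp => ((hmem p).mp hp).2.1.prime.squarefree
      rw [Function.onFun, Nat.coprime_iff_isRelPrime.symm]
      exact (Nat.coprime_primes ((hmem p).mp hp).2.1 ((hmem q).mp hq).2.1).mpr hpq
    rcases hℓ with rfl | ⟨h8, rfl⟩
    · refine ⟨hsqN, fun p hp => ⟨fun hpn => ?_, fun hpn hp2 => ?_, ?_⟩⟩
      · simp [hdvd p hp, hpn]
      · have := (hmem p).mpr ⟨hp2, hp, hpn⟩
        exact ⟨(hdvd p hp).mpr this, h3 p this⟩
      · rintro rfl - -
        exact h2N
    · refine ⟨(Nat.squarefree_mul ((Nat.Prime.coprime_iff_not_dvd Nat.prime_two).mpr h2N)).mpr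
        ⟨Nat.prime_two.prime.squarefree, hsqN⟩, fun p hp => ⟨fun hpn => ?_, fun hpn hp2 => ?_, ?_⟩⟩
      · rw [hp.dvd_mul, hdvd p hp, hmem, Nat.prime_dvd_prime_iff_eq hp Nat.prime_two]
        rintro (rfl | h)
        · exact hpn ((by norm_num : 2 ∣ 8).trans h8)
        · exact hpn h.2.2
      · have := (hmem p).mpr ⟨hp2, hp, hpn⟩
        exact ⟨((hdvd p hp).mpr this).mul_left 2, h3 p this⟩
      · intro _ _ h
        exact absurd h8 h

theorem IsPrimitiveRoot.adjoin_adjoin_add_inv_eq_top {n : ℕ} [NeZero n] {L : Type*} [Field L]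
    [NumberField L] [IsCyclotomicExtension {n} ℚ L] {ζ : L} (hζ : IsPrimitiveRoot ζ n) :
    Algebra.adjoin ℚ⟮ζ + ζ⁻¹⟯ {ζ} = ⊤ := by
  have h := IsCyclotomicExtension.adjoin_primitive_root_eq_top (A := ℚ) hζ
  refine Algebra.eq_top_iff.mpr fun x => ?_
  have hx : x ∈ Algebra.adjoin ℚ {ζ} := h ▸ Algebra.mem_top
  induction hx using Algebra.adjoin_induction with
  | mem x hx => exact Algebra.subset_adjoin hx
  | algebraMap r => exact Subalgebra.algebraMap_mem _ (algebraMap ℚ ℚ⟮ζ + ζ⁻¹⟯ r)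
  | add x y _ _ hx hy => exact add_mem hx hy
  | mul x y _ _ hx hy => exact mul_mem hx hy

/-- Conjugation inverts the root of unity `φ ζ`, so it fixes the generator `ζ + ζ⁻¹`. -/
theorem IsPrimitiveRoot.im_embedding_eq_zero {n : ℕ} (hn : n ≠ 0) {L : Type*} [Field L]
    [NumberField L] {ζ : L} (hζ : IsPrimitiveRoot ζ n) (φ : L →+* ℂ) (y : ℚ⟮ζ + ζ⁻¹⟯) :
    (φ (algebraMap ℚ⟮ζ + ζ⁻¹⟯ L y)).im = 0 := by
  rw [← Complex.conj_eq_iff_im]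
  obtain ⟨y, hy⟩ := y
  change (starRingEnd ℂ) (φ y) = φ y
  induction hy using IntermediateField.adjoin_induction with
  | mem x hx =>
    obtain rfl : x = ζ + ζ⁻¹ := hx
    have hnorm := (hζ.map_of_injective φ.injective).norm'_eq_one hn
    have hconj : (starRingEnd ℂ) (φ ζ) = (φ ζ)⁻¹ := (Complex.inv_eq_conj hnorm).symm
    rw [map_add, map_add, map_inv₀, map_inv₀, hconj, inv_inv, add_comm]
  | algebraMap x => simp
  | add x y _ _ hx hy => rw [map_add, map_add, hx, hy]
  | inv x _ hx => rw [map_inv₀, map_inv₀, hx]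
  | mul x y _ _ hx hy => rw [map_mul, map_mul, hx, hy]

/-! ### The classification of levels -/

theorem mainTheorem3 (n : ℕ) (hn0 : 0 < n) (hn2 : ¬ n ≡ 2 [MOD 4]) (hnpp : ¬ IsPrimePow n)
    {L : Type*} [Field L] [NumberField L] [IsCyclotomicExtension {n} ℚ L]
    (ζ : L) (hζ : IsPrimitiveRoot ζ n) :
    ((∃ p : ℕ, p.Prime ∧ p ∣ n ∧ p ≡ 1 [MOD 4]) → traceTypeLevels ℚ⟮ζ + ζ⁻¹⟯ = ∅) ∧
    ((¬ ∃ p : ℕ, p.Prime ∧ p ∣ n ∧ p ≡ 1 [MOD 4]) →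
      (Odd n → Even n.primeFactors.card →
        traceTypeLevels ℚ⟮ζ + ζ⁻¹⟯ = {oddRamifiedProduct ℚ⟮ζ + ζ⁻¹⟯}) ∧
      (Odd n → Odd n.primeFactors.card →
        traceTypeLevels ℚ⟮ζ + ζ⁻¹⟯ = ∅) ∧
      (∀ m : ℕ, Odd m → n = 4 * m →
        traceTypeLevels ℚ⟮ζ + ζ⁻¹⟯ = {oddRamifiedProduct ℚ⟮ζ + ζ⁻¹⟯}) ∧
      (∀ r m : ℕ, 3 ≤ r → Odd m → n = 2 ^ r * m →
        traceTypeLevels ℚ⟮ζ + ζ⁻¹⟯ =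
          {oddRamifiedProduct ℚ⟮ζ + ζ⁻¹⟯, 2 * oddRamifiedProduct ℚ⟮ζ + ζ⁻¹⟯})) := by
  have : NeZero n := ⟨hn0.ne'⟩
  have hn2' : n ≠ 2 := by
    rintro rfl
    exact hn2 rfl
  have hadj := hζ.adjoin_adjoin_add_inv_eq_top
  let a : ℚ⟮ζ + ζ⁻¹⟯ := IntermediateField.AdjoinSimple.gen ℚ (ζ + ζ⁻¹)
  have ha : algebraMap ℚ⟮ζ + ζ⁻¹⟯ L a = ζ + ζ⁻¹ := rfl
  have hKL := hζ.differentIdeal_eq_top hn0 hn2 hnpp hadj ha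
  have hN := oddRamifiedProduct_eq (n := n) hKL
  have hlevel (ℓ : ℕ) : ℓ ∈ traceTypeLevels ℚ⟮ζ + ζ⁻¹⟯ ↔ (∃ x : L, x ^ 2 = ℓ) ∧
      (∀ p ∈ n.primeFactors.erase 2, p % 4 = 3) ∧
        (ℓ = oddRamifiedProduct ℚ⟮ζ + ζ⁻¹⟯ ∨
          (8 ∣ n ∧ ℓ = 2 * oddRamifiedProduct ℚ⟮ζ + ζ⁻¹⟯)) := by
    rw [mem_traceTypeLevels_iff hn2 hKL, hN, ← squarefree_and_levelCondition_iff hn0]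
    constructor
    · rintro ⟨hsq, ⟨x, hx⟩, h⟩
      exact ⟨⟨algebraMap _ L x, by rw [← map_pow, hx, map_natCast]⟩, hsq, h⟩
    · rintro ⟨⟨x, hx⟩, hsq, h⟩
      obtain ⟨y, hy⟩ := hζ.exists_algebraMap_eq_of_sq_eq_natCast hn0 hn2' hadj ha
        (hζ.im_embedding_eq_zero hn0.ne') (Nat.pos_of_ne_zero hsq.ne_zero) hx
      refine ⟨hsq, ⟨y, (algebraMap _ L).injective ?_⟩, h⟩
      rw [map_pow, hy, hx, map_natCast]
  refine ⟨?_, fun h1 => ?_⟩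
  · rintro ⟨p, hp, hpn, hp1⟩
    refine Set.eq_empty_of_forall_notMem fun ℓ hℓ => ?_
    rw [Nat.ModEq] at hp1
    have := ((hlevel ℓ).mp hℓ).2.1 p (by
      simp only [Finset.mem_erase, Nat.mem_primeFactors]
      exact ⟨by rintro rfl; omega, hp, hpn, hn0.ne'⟩)
    omega
  have h3 : ∀ p ∈ n.primeFactors.erase 2, p.Prime ∧ p ∣ n ∧ p % 4 = 3 := by
    intro p hp
    simp only [Finset.mem_erase, Nat.mem_primeFactors] at hp
    obtain ⟨hp2, hp, hpn, -⟩ := hp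
    refine ⟨hp, hpn, ?_⟩
    have h1' : ¬ p % 4 = 1 := fun h => h1 ⟨p, hp, hpn, h⟩
    have := hp.eq_two_or_odd
    omega
  obtain ⟨y, hy⟩ := hζ.exists_sq_eq_neg_one_pow_mul_prod hn0 _ h3
  rw [← hN] at hy
  have hodd8 (h : Odd n) : ¬ 8 ∣ n := by
    rw [Nat.odd_iff] at h
    omega
  have hodd_erase (h : Odd n) : n.primeFactors.erase 2 = n.primeFactors :=
    Finset.erase_eq_of_notMem fun h2 =>
      (Nat.not_even_iff_odd.mpr h) (even_iff_two_dvd.mpr (Nat.dvd_of_mem_primeFactors h2))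
  have hfour (h4 : 4 ∣ n) : ∃ x : L, x ^ 2 = (oddRamifiedProduct ℚ⟮ζ + ζ⁻¹⟯ : ℕ) := by
    obtain ⟨i, hi⟩ := hζ.exists_sq_eq_neg_one hn0 h4
    -- The factor `i^s` cancels the sign in `y² = (-1)^s ñ`.
    refine ⟨i ^ (n.primeFactors.erase 2).card * y, ?_⟩
    rw [mul_pow, hy, ← pow_mul, mul_comm _ 2, pow_mul, hi, ← mul_assoc, ← mul_pow]
    simp
  refine ⟨fun hodd hcard => ?_, fun hodd hcard => ?_, fun m hm hnm => ?_, fun r m hr hm hnm => ?_⟩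
  · ext ℓ
    rw [hlevel, Set.mem_singleton_iff]
    refine ⟨fun h => h.2.2.resolve_right fun h => hodd8 hodd h.1, ?_⟩
    rintro rfl
    rw [hodd_erase hodd, hcard.neg_one_pow, one_mul] at hy
    exact ⟨⟨y, hy⟩, fun p hp => (h3 p hp).2.2, Or.inl rfl⟩
  · refine Set.eq_empty_of_forall_notMem fun ℓ hℓ => ?_
    obtain ⟨⟨x, hx⟩, -, h⟩ := (hlevel ℓ).mp hℓ
    obtain rfl := h.resolve_right fun h => hodd8 hodd h.1
    rw [hodd_erase hodd, hcard.neg_one_pow, neg_one_mul, ← hx] at hy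
    have hx0 : x ≠ 0 := by
      rintro rfl
      have := hℓ.1.ne_zero
      rw [zero_pow two_ne_zero, eq_comm, Nat.cast_eq_zero] at hx
      exact this hx
    -- Square roots of both `ñ` and `-ñ` would yield a square root of `-1`.
    exact hζ.not_exists_sq_eq_neg_one hodd ⟨y / x, by rw [div_pow, hy]; field_simp⟩
  · have h8 : ¬ 8 ∣ n := by
      rw [Nat.odd_iff] at hm
      omega
    ext ℓ
    rw [hlevel, Set.mem_singleton_iff]
    refine ⟨fun h => h.2.2.resolve_right fun h => h8 h.1, ?_⟩
    rintro rfl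
    exact ⟨hfour ⟨m, hnm⟩, fun p hp => (h3 p hp).2.2, Or.inl rfl⟩
  · have h8 : 8 ∣ n := hnm ▸ (pow_dvd_pow 2 hr).mul_right m
    obtain ⟨x, hx⟩ := hfour ((by norm_num : 4 ∣ 8).trans h8)
    obtain ⟨s, hs⟩ := hζ.exists_sq_eq_two hn0 h8
    ext ℓ
    rw [hlevel, Set.mem_insert_iff, Set.mem_singleton_iff]
    refine ⟨fun h => h.2.2.imp_right And.right, ?_⟩
    rintro (rfl | rfl)
    · exact ⟨⟨x, hx⟩, fun p hp => (h3 p hp).2.2, Or.inl rfl⟩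
    · exact ⟨⟨s * x, by rw [mul_pow, hx, hs]; push_cast; rfl⟩, fun p hp => (h3 p hp).2.2,
        Or.inr ⟨h8, rfl⟩⟩
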